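/- All graphs are finite and simple. For a graph $G=(V,E)$ and $X\subseteq V$, let $\rho_G(X)$ be the rank over $\mathbb F_2$ of the submatrix of the adjacency matrix of $G$ with rows $X$ and columns $V\setminus X$. A rank-decomposition of $G$ is a tree $T$ of maximum degree at most $3$ with a bijection from its leaves to $V$ (the node of a one-node tree counts as a leaf); each edge $e$ of $T$ induces, by deletion, a bipartition $\{X_e,V\setminus X_e\}$ of $V$, and the rank-width is $\operatorname{rw}(G)=\min_T\max_{e\in E(T)}\rho_G(X_e)$, a maximum over the empty set being $0$. The linear rank-width is $\operatorname{lrw}(G)=\min_{(v_1,\dots,v_n)}\max_{1\le i<n}\rho_G(\{v_1,\dots,v_i\})$, the minimum being over all orderings of $V$. Let $\operatorname{tw}(G)$ denote the treewidth, i.e. the minimum over all tree decompositions of $G$ of the largest bag size minus one. For integers $h\ge 0$ and $t\ge 1$, let $B_h$ be the complete binary tree of height $h$ (every path from the root to a leaf has $h$ edges), and let $\Gamma_{h,t}=B_h[K_t]$ be the graph obtained from $B_h$ by replacing every vertex by a clique on $t$ vertices and every edge by the complete bipartite graph between the two corresponding cliques. Then there are absolute constants $C$ and $c>0$ such that, for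 all $h\ge 0$ and $t\ge 1$, $$\operatorname{rw}(\Gamma_{h,t})\le C,\qquad \operatorname{lrw}(\Gamma_{h,t})\ge c\,h,\qquad \operatorname{tw}(\Gamma_{h,t})\ge t-1 .$$ -/

import Mathlib

/-! Treewidth, rank-width and linear rank-width of finite simple graphs, the complete binary tree,
and its lexicographic blow-up by a clique. -/

/-! ### Treewidth -/

/-- A tree decomposition of `G`: a finite tree together with bags of vertices of `G` such that
every vertex lies in a bag, every edge lies inside a bag, and the nodes whose bags contain a
given vertex induce a connected subgraph of the tree. -/
structure TreeDecomposition {V : Type} (G : SimpleGraph V) : Type 1 where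
  Node : Type
  fintypeNode : Fintype Node
  tree : SimpleGraph Node
  isTree : tree.IsTree
  bag : Node → Finset V
  vertex_mem : ∀ v : V, ∃ x : Node, v ∈ bag x
  edge_mem : ∀ u v : V, G.Adj u v → ∃ x : Node, u ∈ bag x ∧ v ∈ bag x
  connected : ∀ v : V, (tree.induce {x : Node | v ∈ bag x}).Connected

attribute [instance] TreeDecomposition.fintypeNode

/-- The width of a tree decomposition: the largest size of a bag, minus one. (The largest bag of a
decomposition of a nonempty graph is nonempty, so the subtraction is then the ordinary one.) -/
def TreeDecomposition.width {V : Type} {G : SimpleGraph V} (D : TreeDecomposition G) : ℕ :=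
  (Finset.univ.sup fun x : D.Node => (D.bag x).card) - 1

/-- A finite graph has a tree decomposition, with all vertices in one bag; so the infimum in the
definition of treewidth is a minimum. -/
instance TreeDecomposition.instNonempty {V : Type} [Fintype V] (G : SimpleGraph V) :
    Nonempty (TreeDecomposition G) :=
  ⟨{ Node := Unit
     fintypeNode := inferInstance
     tree := ⊥
     isTree := SimpleGraph.IsTree.of_subsingleton
     bag := fun _ => Finset.univ
     vertex_mem := fun v => ⟨(), Finset.mem_univ v⟩
     edge_mem := fun u v _ => ⟨(), Finset.mem_univ u, Finset.mem_univ v⟩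
     connected := fun v =>
       haveI : Nonempty {x : Unit | v ∈ (Finset.univ : Finset V)} := ⟨⟨(), Finset.mem_univ v⟩⟩
       SimpleGraph.Connected.mk fun a b => by rw [Subsingleton.elim a b] }⟩

/-- The treewidth of a finite graph: the minimum width of a tree decomposition. -/
noncomputable def treewidth {V : Type} [Fintype V] (G : SimpleGraph V) : ℕ :=
  ⨅ D : TreeDecomposition G, D.width

/-! ### Cut-rank and rank-width -/

open Classical in
/-- The cut-rank of `X`: the rank over `𝔽₂` of the submatrix of the adjacency matrix of `G` with
rows indexed by `X` and columns indexed by the complement of `X`. -/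
noncomputable def cutRank {V : Type} [Fintype V] (G : SimpleGraph V) (X : Set V) : ℕ :=
  ((G.adjMatrix (ZMod 2)).submatrix (fun u : X => (u : V))
    (fun v : (Xᶜ : Set V) => (v : V))).rank

/-- A rank-decomposition of `G`: a finite tree in which every node has at most three neighbours,
together with a bijection from its leaves to the vertices of `G`. A leaf is a node with at most
one neighbour, so that the only node of a one-node tree is a leaf. -/
structure RankDecomposition {V : Type} (G : SimpleGraph V) : Type 1 where
  Node : Type
  fintypeNode : Fintype Node
  tree : SimpleGraph Node
  isTree : tree.IsTree
  subcubic : ∀ x : Node, (tree.neighborSet x).ncard ≤ 3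
  leafEquiv : {x : Node // (tree.neighborSet x).ncard ≤ 1} ≃ V

attribute [instance] RankDecomposition.fintypeNode

/-- For an edge `ab` of the tree, the vertices of `G` that label the leaves in the component of `a`
after the edge `ab` is deleted. -/
def RankDecomposition.side {V : Type} {G : SimpleGraph V} (D : RankDecomposition G)
    (a b : D.Node) : Set V :=
  {v : V | (D.tree.deleteEdges {s(a, b)}).Reachable a (D.leafEquiv.symm v : D.Node)}

open Classical in
/-- The width of a rank-decomposition: the maximum of the cut-ranks of the cuts induced by the
edges of the tree (and `0` if there are no edges). Every edge is counted in both orientations,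
which yields the two complementary sides of its cut; they have the same cut-rank. -/
noncomputable def RankDecomposition.width {V : Type} [Fintype V] {G : SimpleGraph V}
    (D : RankDecomposition G) : ℕ :=
  (Finset.univ.filter fun p : D.Node × D.Node => D.tree.Adj p.1 p.2).sup
    fun p => cutRank G (D.side p.1 p.2)

/-- The rank-width of a nonempty finite graph: the minimum width of a rank-decomposition. The
value is taken in `ℕ∞`, so that an upper bound by a natural number includes the existence of a
rank-decomposition. -/
noncomputable def rankWidth {V : Type} [Fintype V] (G : SimpleGraph V) : ℕ∞ :=
  ⨅ D : RankDecomposition G, (D.width : ℕ∞)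

/-! ### Linear rank-width -/

/-- The width of a linear layout `π` of the `n` vertices of `G`: the maximum, over `1 ≤ i < n`, of
the cut-rank of the set of the first `i` vertices (and `0` if `n ≤ 1`). -/
noncomputable def layoutWidth {V : Type} [Fintype V] (G : SimpleGraph V)
    (π : V ≃ Fin (Fintype.card V)) : ℕ :=
  (Finset.Ico 1 (Fintype.card V)).sup fun i => cutRank G {v : V | (π v : ℕ) < i}

/-- The linear rank-width of a finite graph: the minimum width of a linear layout. (Linear layouts
exist, so the infimum is a minimum.) -/
noncomputable def linearRankWidth {V : Type} [Fintype V] (G : SimpleGraph V) : ℕ :=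
  ⨅ π : V ≃ Fin (Fintype.card V), layoutWidth G π

/-! ### The blow-up of the complete binary tree -/

/-- The nodes of the complete binary tree of height `h`: the binary words of length at most `h`,
where a word describes the way from the root (the empty word) to the node. -/
abbrev BinaryTreeNode (h : ℕ) : Type := {w : List Bool // w.length ≤ h}

noncomputable instance BinaryTreeNode.instFintype (h : ℕ) : Fintype (BinaryTreeNode h) :=
  (List.finite_length_le Bool h).fintype

/-- The complete binary tree of height `h` (with `h` edges on every way from the root to a leaf):
the children of a node `w` of depth less than `h` are `w` followed by one more letter. -/
def completeBinaryTree (h : ℕ) : SimpleGraph (BinaryTreeNode h) where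
  Adj u v := (∃ b : Bool, v.1 = u.1 ++ [b]) ∨ (∃ b : Bool, u.1 = v.1 ++ [b])
  symm := ⟨fun _ _ huv => Or.symm huv⟩
  loopless := ⟨fun u hu => by simp at hu⟩

/-- The lexicographic product `G[H]`: every vertex of `G` is replaced by a copy of `H`, and every
edge of `G` by a complete bipartite graph between the two copies. -/
def lexProduct {V W : Type} (G : SimpleGraph V) (H : SimpleGraph W) : SimpleGraph (V × W) where
  Adj p q := G.Adj p.1 q.1 ∨ (p.1 = q.1 ∧ H.Adj p.2 q.2)
  symm := ⟨fun _ _ hpq => hpq.imp (fun e => e.symm) (fun e => ⟨e.1.symm, e.2.symm⟩)⟩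
  loopless := ⟨fun _ hp => hp.elim (fun e => e.ne rfl) (fun e => e.2.ne rfl)⟩

/-- The lexicographic blow-up `B_h[K_t]` of the complete binary tree of height `h` by a
`t`-clique. -/
def blowUp (h t : ℕ) : SimpleGraph (BinaryTreeNode h × Fin t) :=
  lexProduct (completeBinaryTree h) (⊤ : SimpleGraph (Fin t))

/-! Rank-width: descend the tree from the root, peeling off the vertices over a node one at a time
and separating its two subtrees once they are used up. The vertices of such a part `blowUpPart` fall
into boundedly many classes with equal neighbourhoods outside it, so its cut-rank is at most 4.
`RecursiveSplitting` turns this recursion into a rank-decomposition.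

Linear rank-width: fix one copy of the binary tree in the blow-up and stop the layout when it has
met exactly `n = (4 ^ k - 1) / 3` nodes of that copy, with `k` about `h / 2`. Let `S` be the set of
these nodes. Adding or subtracting a full subtree at each boundary edge of `S` writes `n`, up to the
whole tree, as a sum of terms `± (2 ^ j - 1)`, one per boundary edge (`le_mul_edgeBoundary`). The
subadditive function `dyadicNorm` is at most 2 on each term but at least `k / 3` on `n`, whose
binary digits alternate, so the boundary has order `h` edges. A fixed fraction of them forms an
induced matching across the cut (`edgeBoundary_le_cutRank`), which bounds the cut-rank from below.

Treewidth: the subtrees of nodes whose bags contain the vertices of a clique meet pairwise, so by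
the Helly property one bag contains the whole clique. -/

/-! ### Cut-rank -/

section CutRank

variable {V : Type} [Fintype V] (G : SimpleGraph V)

theorem cutRank_eq_rank (X : Set V) [DecidableRel G.Adj] [Fintype (Xᶜ : Set V)] :
    cutRank G X = ((G.adjMatrix (ZMod 2)).submatrix (fun u : X => (u : V))
      (fun v : (Xᶜ : Set V) => (v : V))).rank := by
  unfold cutRank
  congr!

theorem cutRank_compl_le (X : Set V) : cutRank G Xᶜ ≤ cutRank G X := by
  classical
  rw [cutRank_eq_rank, cutRank_eq_rank, ← Matrix.rank_transpose, Matrix.transpose_submatrix,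
    SimpleGraph.transpose_adjMatrix]
  exact Matrix.rank_submatrix_le ((G.adjMatrix (ZMod 2)).submatrix (fun u : X => (u : V))
    (fun v : (Xᶜ : Set V) => (v : V))) (fun u : (Xᶜᶜ : Set V) => ⟨u, not_not.mp u.2⟩) id

theorem cutRank_compl (X : Set V) : cutRank G Xᶜ = cutRank G X :=
  (cutRank_compl_le G X).antisymm (by simpa using cutRank_compl_le G Xᶜ)

/-- If adjacency between `X` and its complement depends on the vertex of `X` only through a
function to a finite type, then that type bounds the cut-rank. -/
theorem cutRank_le_card {κ : Type} [Fintype κ] (X : Set V) (f : V → κ) (r : κ → V → Prop)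
    (hf : ∀ u ∈ X, ∀ v ∉ X, (G.Adj u v ↔ r (f u) v)) : cutRank G X ≤ Fintype.card κ := by
  classical
  rw [cutRank_eq_rank]
  -- Row `u` depends only on `f u`, so the matrix factors through `κ`.
  let A : Matrix X κ (ZMod 2) := Matrix.of fun u k => if f u = k then 1 else 0
  let B : Matrix κ (Xᶜ : Set V) (ZMod 2) := Matrix.of fun k v => if r k v then 1 else 0
  have hAB : (G.adjMatrix (ZMod 2)).submatrix (fun u : X => (u : V))
      (fun v : (Xᶜ : Set V) => (v : V)) = A * B := by
    ext u v
    simp only [A, B, Matrix.mul_apply, Matrix.submatrix_apply, SimpleGraph.adjMatrix_apply,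
      hf u u.2 v v.2, Matrix.of_apply, ite_mul, one_mul, zero_mul, Finset.sum_ite_eq,
      Finset.mem_univ, if_true]
  rw [hAB]
  exact (Matrix.rank_mul_le_left A B).trans A.rank_le_card_width

/-- The size of a matching that is induced in the bipartite graph between `X` and its complement is
a lower bound for the cut-rank. -/
theorem card_le_cutRank {ι : Type} [Fintype ι] (X : Set V) (a b : ι → V) (ha : ∀ i, a i ∈ X)
    (hb : ∀ i, b i ∉ X) (hab : ∀ i j, G.Adj (a i) (b j) ↔ i = j) :
    Fintype.card ι ≤ cutRank G X := by
  classical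
  rw [cutRank_eq_rank]
  have h := Matrix.rank_submatrix_le ((G.adjMatrix (ZMod 2)).submatrix (fun u : X => (u : V))
      (fun v : (Xᶜ : Set V) => (v : V))) (fun i => ⟨a i, ha i⟩) (fun i => ⟨b i, hb i⟩)
  have h1 : (((G.adjMatrix (ZMod 2)).submatrix (fun u : X => (u : V))
      (fun v : (Xᶜ : Set V) => (v : V))).submatrix (fun i => (⟨a i, ha i⟩ : X))
      (fun i => (⟨b i, hb i⟩ : (Xᶜ : Set V)))) = (1 : Matrix ι ι (ZMod 2)) := by
    ext i j
    simp [SimpleGraph.adjMatrix_apply, hab, Matrix.one_apply]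
  rw [h1, Matrix.rank_one] at h
  exact h

end CutRank

/-! ### Rank-decompositions from recursive splittings -/

/-- A recursive splitting of a finite set: `part []` is the whole set, a part with at least two
elements is divided into two nonempty parts, and the other parts are not divided. Addresses are
read from right to left, so that the parent of an address is its tail. -/
structure RecursiveSplitting (V : Type) [Fintype V] where
  part : List Bool → Finset V
  part_nil : part [] = Finset.univ
  part_cons_subset : ∀ b w, part (b :: w) ⊆ part w
  disjoint : ∀ w, Disjoint (part (true :: w)) (part (false :: w))
  part_cons_eq_empty : ∀ b w, (part w).card ≤ 1 → part (b :: w) = ∅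
  part_cons_nonempty : ∀ b w, 2 ≤ (part w).card → (part (b :: w)).Nonempty
  exists_mem_part_cons : ∀ w, 2 ≤ (part w).card → ∀ v ∈ part w, ∃ b, v ∈ part (b :: w)

namespace RecursiveSplitting

variable {V : Type} [Fintype V] (R : RecursiveSplitting V)

theorem two_le_card_of_cons_nonempty {b : Bool} {w : List Bool} (h : (R.part (b :: w)).Nonempty) :
    2 ≤ (R.part w).card := by
  by_contra hlt
  rw [R.part_cons_eq_empty b w (by omega)] at h
  exact Finset.not_nonempty_empty h

theorem eq_of_mem {b c : Bool} {w : List Bool} {v : V} (hb : v ∈ R.part (b :: w))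
    (hc : v ∈ R.part (c :: w)) : b = c := by
  have h := Finset.disjoint_left.mp (R.disjoint w)
  cases b <;> cases c <;> first | rfl | exact absurd hb (h hc) | exact absurd hc (h hb)

theorem part_subset_of_suffix {u w : List Bool} (h : u <:+ w) : R.part w ⊆ R.part u := by
  obtain ⟨l, rfl⟩ := h
  induction l with
  | nil => rfl
  | cons b l ih => exact (R.part_cons_subset b (l ++ u)).trans ih

/-- The address of every part that contains `v` is a suffix of the address of a part `{v}`. -/
theorem suffix_of_mem {v : V} {a : List Bool} (ha : (R.part a).card = 1) (hva : v ∈ R.part a)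
    {w : List Bool} (hw : v ∈ R.part w) : w <:+ a := by
  induction w with
  | nil => exact List.nil_suffix
  | cons b w ih =>
    obtain ⟨l, hl⟩ := ih (R.part_cons_subset b w hw)
    rcases List.eq_nil_or_concat l with rfl | ⟨l, c, rfl⟩
    · rw [List.nil_append] at hl
      subst hl
      rw [R.part_cons_eq_empty b w ha.le] at hw
      exact absurd hw (Finset.notMem_empty v)
    · have hl' : l ++ c :: w = a := by simpa using hl
      have hc : v ∈ R.part (c :: w) := R.part_subset_of_suffix ⟨l, hl'⟩ hva
      rw [R.eq_of_mem hw hc]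
      exact ⟨l, hl'⟩

/-- Each step down loses the nonempty sibling part, so the cardinality drops by at least one. This
bounds the depth, and thereby makes the tree finite. -/
theorem length_add_card_le {w : List Bool} (hw : (R.part w).Nonempty) :
    w.length + (R.part w).card ≤ Fintype.card V := by
  induction w with
  | nil => simp [R.part_nil]
  | cons b w ih =>
    have h2 := R.two_le_card_of_cons_nonempty hw
    have hlt : (R.part (b :: w)).card < (R.part w).card := by
      obtain ⟨v, hv⟩ := R.part_cons_nonempty (!b) w h2
      refine Finset.card_lt_card ⟨R.part_cons_subset b w, fun hsub => ?_⟩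
      have := R.eq_of_mem hv (hsub (R.part_cons_subset _ w hv))
      cases b <;> simp at this
    have := ih (Finset.card_pos.mp (by omega))
    simp only [List.length_cons]
    omega

/-- Every element lies in a part of size one. -/
theorem exists_card_eq_one (v : V) : ∃ a, (R.part a).card = 1 ∧ v ∈ R.part a := by
  by_contra! hcon
  -- If no part `{v}` existed, `v` could be followed to every depth, against `length_add_card_le`.
  have key : ∀ n : ℕ, ∃ w : List Bool, w.length = n ∧ v ∈ R.part w := by
    intro n
    induction n with
    | zero => exact ⟨[], rfl, by simp [R.part_nil]⟩
    | succ n ih =>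
      obtain ⟨w, rfl, hw⟩ := ih
      have h1 : (R.part w).card ≠ 1 := fun h => hcon w h hw
      have h0 : 0 < (R.part w).card := Finset.card_pos.mpr ⟨v, hw⟩
      obtain ⟨b, hb⟩ := R.exists_mem_part_cons w (by omega) v hw
      exact ⟨b :: w, rfl, hb⟩
  obtain ⟨w, hlen, hw⟩ := key (Fintype.card V)
  have := R.length_add_card_le ⟨v, hw⟩
  have h0 : 0 < (R.part w).card := Finset.card_pos.mpr ⟨v, hw⟩
  omega

/-- The addresses of the nonempty parts. -/
abbrev Node : Type := {w : List Bool // (R.part w).Nonempty}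

theorem finite_node : Finite R.Node :=
  ((List.finite_length_le Bool (Fintype.card V)).subset
    fun _ hw => (Nat.le_add_right _ _).trans (R.length_add_card_le hw)).to_subtype

/-- The tree of the nonempty parts. -/
def tree : SimpleGraph R.Node where
  Adj u v := (∃ b : Bool, u.1 = b :: v.1) ∨ ∃ b : Bool, v.1 = b :: u.1
  symm := ⟨fun _ _ huv => huv.symm⟩
  loopless := ⟨fun u hu => by simp at hu⟩

/-- The parent of a node other than the root. -/
def parent (b : Bool) (w : List Bool) (h : (R.part (b :: w)).Nonempty) : R.Node :=
  ⟨w, h.mono (R.part_cons_subset b w)⟩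

theorem adj_parent {b : Bool} {w : List Bool} (h : (R.part (b :: w)).Nonempty) :
    R.tree.Adj ⟨b :: w, h⟩ (R.parent b w h) := Or.inl ⟨b, rfl⟩

/-- Without the edge from a node `c` to its parent, every node below `c` is still joined to `c`. -/
theorem reachable_of_suffix {b : Bool} {w : List Bool} (h : (R.part (b :: w)).Nonempty)
    (x : R.Node) (hx : b :: w <:+ x.1) :
    (R.tree.deleteEdges {s(⟨b :: w, h⟩, R.parent b w h)}).Reachable ⟨b :: w, h⟩ x := by
  obtain ⟨x, hxne⟩ := x
  obtain ⟨l, rfl⟩ := hx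
  induction l with
  | nil => exact SimpleGraph.Reachable.refl _
  | cons c l ih =>
    refine (ih (R.parent c _ hxne).2).trans (SimpleGraph.Adj.reachable ?_)
    rw [SimpleGraph.deleteEdges_adj]
    refine ⟨(R.adj_parent hxne).symm, fun hmem => ?_⟩
    rcases Sym2.eq_iff.mp (Set.mem_singleton_iff.mp hmem) with ⟨-, h2⟩ | ⟨h1, -⟩
    · have := congrArg (fun y : R.Node => y.1.length) h2
      simp [parent] at this
      omega
    · have := congrArg (fun y : R.Node => y.1.length) h1
      simp [parent] at this
      omega

/-- Without the edge from a node `c` to its parent, every node that is not below `c` is still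
joined to the root, hence to the parent of `c`. -/
theorem reachable_of_not_suffix {b : Bool} {w : List Bool} (h : (R.part (b :: w)).Nonempty)
    (x : R.Node) (hx : ¬ b :: w <:+ x.1) :
    (R.tree.deleteEdges {s(⟨b :: w, h⟩, R.parent b w h)}).Reachable (R.parent b w h) x := by
  have hroot : (R.part []).Nonempty := (h.mono (R.part_subset_of_suffix List.nil_suffix))
  have key : ∀ (x : List Bool) (hxne : (R.part x).Nonempty), ¬ b :: w <:+ x →
      (R.tree.deleteEdges {s(⟨b :: w, h⟩, R.parent b w h)}).Reachable ⟨[], hroot⟩ ⟨x, hxne⟩ := by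
    intro x hxne hx
    induction x with
    | nil => exact SimpleGraph.Reachable.refl _
    | cons c l ih =>
      refine (ih (R.parent c _ hxne).2
        fun hs => hx (hs.trans (List.suffix_cons c l))).trans (SimpleGraph.Adj.reachable ?_)
      rw [SimpleGraph.deleteEdges_adj]
      refine ⟨(R.adj_parent hxne).symm, fun hmem => ?_⟩
      rcases Sym2.eq_iff.mp (Set.mem_singleton_iff.mp hmem) with ⟨h1, -⟩ | ⟨-, h2⟩
      · have h1' : l = b :: w := congrArg Subtype.val h1
        exact hx (h1' ▸ List.suffix_cons c l)
      · have h2' : c :: l = b :: w := congrArg Subtype.val h2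
        exact hx (h2' ▸ List.suffix_rfl)
  exact (key w _ fun hs => by simpa using hs.length_le).symm.trans (key x.1 x.2 hx)

/-- Without the edge from a node `c` to its parent, no node below `c` is joined to any other
node. -/
theorem suffix_iff_of_reachable {b : Bool} {w : List Bool} (h : (R.part (b :: w)).Nonempty)
    {x y : R.Node}
    (hxy : (R.tree.deleteEdges {s(⟨b :: w, h⟩, R.parent b w h)}).Reachable x y) :
    b :: w <:+ x.1 ↔ b :: w <:+ y.1 := by
  -- The only edge between the nodes below `b :: w` and the others is the deleted one.
  have step : ∀ (c : Bool) (u v : R.Node), u.1 = c :: v.1 →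
      s(u, v) ≠ s(⟨b :: w, h⟩, R.parent b w h) → (b :: w <:+ u.1 ↔ b :: w <:+ v.1) := by
    rintro c ⟨u, hu⟩ ⟨v, hv⟩ (rfl : u = c :: v) hne
    rw [List.suffix_cons_iff]
    refine or_iff_right fun heq => hne ?_
    rw [List.cons.injEq] at heq
    obtain ⟨rfl, rfl⟩ := heq
    rfl
  obtain ⟨p⟩ := hxy
  induction p with
  | nil => rfl
  | @cons u v _ huv _ ih =>
    rw [SimpleGraph.deleteEdges_adj, Set.mem_singleton_iff] at huv
    obtain ⟨⟨c, hc⟩ | ⟨c, hc⟩, hne⟩ := huv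
    · exact (step c u v hc hne).trans ih
    · exact (step c v u hc (by rwa [Sym2.eq_swap])).symm.trans ih

/-- Every node is joined to the root through its tails. Every edge is a bridge: once it is deleted,
having `b :: w` as a suffix is invariant under reachability, and this property distinguishes its
ends. -/
theorem isTree_tree [Nonempty V] : R.tree.IsTree := by
  refine ⟨?_, ?_⟩
  · have hroot : (R.part []).Nonempty := R.part_nil ▸ Finset.univ_nonempty
    have key : ∀ (x : List Bool) (hxne : (R.part x).Nonempty),
        R.tree.Reachable ⟨[], hroot⟩ ⟨x, hxne⟩ := by
      intro x hxne
      induction x with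
      | nil => exact SimpleGraph.Reachable.refl _
      | cons c l ih =>
        exact (ih (R.parent c _ hxne).2).trans (R.adj_parent hxne).symm.reachable
    have : Nonempty R.Node := ⟨⟨[], hroot⟩⟩
    exact ⟨fun x y => (key x.1 x.2).symm.trans (key y.1 y.2)⟩
  · have key : ∀ (b : Bool) (w : List Bool) (h : (R.part (b :: w)).Nonempty),
        R.tree.IsBridge s(⟨b :: w, h⟩, R.parent b w h) := by
      intro b w h
      rw [SimpleGraph.isBridge_iff]
      intro hr
      have := ((R.suffix_iff_of_reachable h hr).mp List.suffix_rfl).length_le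
      simp [parent] at this
    rw [SimpleGraph.isAcyclic_iff_forall_adj_isBridge]
    rintro ⟨u, hu⟩ ⟨v, hv⟩ (⟨b, hb⟩ | ⟨b, hb⟩)
    · dsimp only at hb
      subst hb
      exact key b v hu
    · dsimp only at hb
      subst hb
      rw [Sym2.eq_swap]
      exact key b u hv

theorem neighborSet_val_subset (x : R.Node) :
    Subtype.val '' R.tree.neighborSet x ⊆ {x.1.tail, true :: x.1, false :: x.1} := by
  rintro _ ⟨y, ⟨b, hb⟩ | ⟨b, hb⟩, rfl⟩
  · simp [hb]
  · cases b <;> simp [hb]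

theorem ncard_neighborSet_le (x : R.Node) : (R.tree.neighborSet x).ncard ≤ 3 := by
  rw [← Set.ncard_image_of_injective _ Subtype.val_injective]
  refine (Set.ncard_le_ncard (R.neighborSet_val_subset x) (Set.toFinite _)).trans ?_
  refine (Set.ncard_insert_le _ _).trans ?_
  have := Set.ncard_insert_le (true :: x.1) {false :: x.1}
  rw [Set.ncard_singleton] at this
  omega

/-- A part with two or more elements has two children. A singleton has none, which leaves at most
the parent; this includes the root of a one-node tree. -/
theorem ncard_neighborSet_le_one_iff (x : R.Node) :
    (R.tree.neighborSet x).ncard ≤ 1 ↔ (R.part x.1).card = 1 := by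
  have := R.finite_node
  constructor
  · intro h
    by_contra hne
    have h2 : 2 ≤ (R.part x.1).card := by
      have := Finset.card_pos.mpr x.2
      omega
    rw [Set.ncard_le_one_iff (Set.toFinite _)] at h
    have := h (a := ⟨true :: x.1, R.part_cons_nonempty _ _ h2⟩)
      (b := ⟨false :: x.1, R.part_cons_nonempty _ _ h2⟩) (Or.inr ⟨true, rfl⟩)
      (Or.inr ⟨false, rfl⟩)
    simp at this
  · intro h
    rw [Set.ncard_le_one_iff (Set.toFinite _)]
    have key : ∀ y ∈ R.tree.neighborSet x, y.1 = x.1.tail := by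
      rintro y (⟨b, hb⟩ | ⟨b, hb⟩)
      · simp [hb]
      · have := R.two_le_card_of_cons_nonempty (hb ▸ y.2)
        omega
    intro y z hy hz
    exact Subtype.ext ((key y hy).trans (key z hz).symm)

/-- The address of the part `{v}`. -/
noncomputable def leaf (v : V) : {x : R.Node // (R.tree.neighborSet x).ncard ≤ 1} :=
  ⟨⟨(R.exists_card_eq_one v).choose, v, (R.exists_card_eq_one v).choose_spec.2⟩,
    (R.ncard_neighborSet_le_one_iff _).mpr (R.exists_card_eq_one v).choose_spec.1⟩

theorem card_part_leaf (v : V) : (R.part (R.leaf v).1.1).card = 1 :=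
  (R.exists_card_eq_one v).choose_spec.1

theorem mem_part_leaf (v : V) : v ∈ R.part (R.leaf v).1.1 :=
  (R.exists_card_eq_one v).choose_spec.2

theorem leaf_bijective : Function.Bijective R.leaf := by
  constructor
  · intro u v huv
    have hu := R.mem_part_leaf u
    rw [huv] at hu
    exact Finset.card_le_one_iff.mp (R.card_part_leaf v).le hu (R.mem_part_leaf v)
  · rintro ⟨⟨w, hw⟩, hl⟩
    have h1 : (R.part w).card = 1 := (R.ncard_neighborSet_le_one_iff ⟨w, hw⟩).mp hl
    obtain ⟨v, hv⟩ := id hw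
    refine ⟨v, Subtype.ext (Subtype.ext ?_)⟩
    have h2 : (R.leaf v).1.1 <:+ w := R.suffix_of_mem h1 hv (R.mem_part_leaf v)
    exact h2.eq_of_length
      (le_antisymm h2.length_le
        (R.suffix_of_mem (R.card_part_leaf v) (R.mem_part_leaf v) hv).length_le)

theorem suffix_leaf_iff (v : V) (w : List Bool) : w <:+ (R.leaf v).1.1 ↔ v ∈ R.part w :=
  ⟨fun h => R.part_subset_of_suffix h (R.mem_part_leaf v),
    R.suffix_of_mem (R.card_part_leaf v) (R.mem_part_leaf v)⟩

/-- The rank-decomposition given by a recursive splitting of the set of vertices. -/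
noncomputable def rankDecomposition [Nonempty V] (G : SimpleGraph V) : RankDecomposition G where
  Node := R.Node
  fintypeNode := have := R.finite_node; Fintype.ofFinite _
  tree := R.tree
  isTree := R.isTree_tree
  subcubic := R.ncard_neighborSet_le
  leafEquiv := (Equiv.ofBijective R.leaf R.leaf_bijective).symm

theorem side_rankDecomposition [Nonempty V] (G : SimpleGraph V) {b : Bool} {w : List Bool}
    (h : (R.part (b :: w)).Nonempty) :
    (R.rankDecomposition G).side ⟨b :: w, h⟩ (R.parent b w h) = R.part (b :: w) := by
  ext v
  rw [Finset.mem_coe, ← R.suffix_leaf_iff]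
  exact ⟨fun hr => (R.suffix_iff_of_reachable h hr).mp List.suffix_rfl,
    R.reachable_of_suffix h (R.leaf v).1⟩

theorem side_rankDecomposition' [Nonempty V] (G : SimpleGraph V) {b : Bool} {w : List Bool}
    (h : (R.part (b :: w)).Nonempty) :
    (R.rankDecomposition G).side (R.parent b w h) ⟨b :: w, h⟩ = (R.part (b :: w) : Set V)ᶜ := by
  ext v
  rw [Set.mem_compl_iff, Finset.mem_coe, ← R.suffix_leaf_iff]
  change (R.tree.deleteEdges {s(R.parent b w h, ⟨b :: w, h⟩)}).Reachable _ (R.leaf v).1 ↔ _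
  rw [Sym2.eq_swap]
  refine ⟨fun hr hs => ?_, R.reachable_of_not_suffix h (R.leaf v).1⟩
  have := ((R.suffix_iff_of_reachable h hr).mpr hs).length_le
  simp [parent] at this

theorem rankWidth_le [Nonempty V] (G : SimpleGraph V) {C : ℕ}
    (hC : ∀ w, (R.part w).Nonempty → cutRank G (R.part w) ≤ C) : rankWidth G ≤ C := by
  classical
  refine (iInf_le _ (R.rankDecomposition G)).trans (Nat.cast_le.mpr ?_)
  unfold RankDecomposition.width
  refine Finset.sup_le ?_
  rintro ⟨⟨u, hu⟩, ⟨v, hv⟩⟩ huv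
  rw [Finset.mem_filter] at huv
  obtain ⟨b, hb⟩ | ⟨b, hb⟩ := huv.2
  · dsimp only at hb
    subst hb
    exact (congrArg (cutRank G) (R.side_rankDecomposition G hu)).trans_le (hC _ hu)
  · dsimp only at hb
    subst hb
    exact (congrArg (cutRank G) (R.side_rankDecomposition' G hv)).trans_le
      ((cutRank_compl G _).trans_le (hC _ hv))

end RecursiveSplitting

/-- If a class `P` of sets of vertices contains the whole set, and every member with at least two
elements is the disjoint union of two nonempty members, then a bound for the cut-ranks of the
members is a bound for the rank-width. -/
theorem rankWidth_le_of_forall_exists_split {V : Type} [Fintype V] [Nonempty V] [DecidableEq V]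
    (G : SimpleGraph V) (P : Finset V → Prop) (huniv : P Finset.univ)
    (hsplit : ∀ X, P X → 2 ≤ X.card → ∃ Y Z, P Y ∧ P Z ∧ Y.Nonempty ∧ Z.Nonempty ∧ Disjoint Y Z ∧
      X = Y ∪ Z) {C : ℕ} (hC : ∀ X, P X → cutRank G X ≤ C) : rankWidth G ≤ C := by
  classical
  -- The splitting is made total, with empty pieces where none is given, so that the parts can be
  -- defined by plain recursion on addresses. Membership in `P` is recovered afterwards for the
  -- nonempty parts.
  have hg : ∀ X : Finset V, ∃ g : Bool → Finset V,
      (∀ b, g b ⊆ X) ∧ Disjoint (g true) (g false) ∧ (X.card ≤ 1 → ∀ b, g b = ∅) ∧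
      (P X → 2 ≤ X.card → ∀ b, (g b).Nonempty ∧ P (g b)) ∧
      (P X → 2 ≤ X.card → ∀ v ∈ X, ∃ b, v ∈ g b) := by
    intro X
    by_cases h : P X ∧ 2 ≤ X.card
    · obtain ⟨Y, Z, hY, hZ, hYn, hZn, hd, rfl⟩ := hsplit X h.1 h.2
      refine ⟨fun b => if b then Y else Z, ?_, by simpa using hd, fun h1 => ?_, fun _ _ => ?_,
        fun _ _ v hv => ?_⟩
      · rintro (_ | _) <;> simp
      · omega
      · rintro (_ | _) <;> simp [*]
      · rcases Finset.mem_union.mp hv with hv | hv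
        · exact ⟨true, by simpa using hv⟩
        · exact ⟨false, by simpa using hv⟩
    · refine ⟨fun _ => ∅, fun _ => Finset.empty_subset X, Finset.disjoint_empty_left _,
        fun _ _ => rfl, fun h1 h2 => absurd ⟨h1, h2⟩ h, fun h1 h2 => absurd ⟨h1, h2⟩ h⟩
  choose g hsub hdisj hempty hne hmem using hg
  let f : List Bool → Finset V := fun w => w.rec Finset.univ fun b _ X => g X b
  have hP : ∀ w, (f w).Nonempty → P (f w) := by
    intro w
    induction w with
    | nil => exact fun _ => huniv
    | cons b w ih =>
      intro h
      have h2 : 2 ≤ (f w).card := by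
        by_contra hlt
        have : f (b :: w) = ∅ := hempty (f w) (by omega) b
        exact h.ne_empty this
      exact (hne (f w) (ih (Finset.card_pos.mp (by omega))) h2 b).2
  have hP2 : ∀ w, 2 ≤ (f w).card → P (f w) := fun w h => hP w (Finset.card_pos.mp (by omega))
  let R : RecursiveSplitting V :=
    { part := f
      part_nil := rfl
      part_cons_subset := fun b w => hsub (f w) b
      disjoint := fun w => hdisj (f w)
      part_cons_eq_empty := fun b w h => hempty (f w) h b
      part_cons_nonempty := fun b w h => (hne (f w) (hP2 w h) h b).1
      exists_mem_part_cons := fun w h => hmem (f w) (hP2 w h) h }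
  exact R.rankWidth_le G fun w hw => hC _ (hP w hw)

/-! ### The rank-width of the blow-up -/

/-- The vertices over the nodes below `w`, without the first `k` vertices over `w` itself. -/
noncomputable def blowUpPart (h t : ℕ) (w : List Bool) (k : ℕ) :
    Finset (BinaryTreeNode h × Fin t) :=
  open Classical in
  Finset.univ.filter fun p => w <+: p.1.1 ∧ (p.1.1 = w → k ≤ p.2)

theorem mem_blowUpPart {h t : ℕ} {w : List Bool} {k : ℕ} {p : BinaryTreeNode h × Fin t} :
    p ∈ blowUpPart h t w k ↔ w <+: p.1.1 ∧ (p.1.1 = w → k ≤ p.2) := by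
  simp [blowUpPart]

theorem blowUp_adj {h t : ℕ} {p q : BinaryTreeNode h × Fin t} :
    (blowUp h t).Adj p q ↔ ((∃ b, q.1.1 = p.1.1 ++ [b]) ∨ ∃ b, p.1.1 = q.1.1 ++ [b]) ∨
      (p.1 = q.1 ∧ p.2 ≠ q.2) :=
  Iff.rfl

/-- Only vertices over `w` or over a child of `w` have neighbours outside the part. Those of the
first kind see the vertices over the parent of `w` and the removed ones over `w`; those of the
second see only the latter. Two Boolean flags record the kind, hence the bound 4. -/
theorem cutRank_blowUpPart_le (h t : ℕ) (w : List Bool) (k : ℕ) :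
    cutRank (blowUp h t) (blowUpPart h t w k) ≤ 4 := by
  classical
  refine cutRank_le_card (κ := Bool × Bool) (blowUp h t) _
    (fun p => (decide (p.1.1 = w), decide (∃ b, p.1.1 = w ++ [b])))
    (fun c q => (c.1 = true ∧ ((∃ b, q.1.1 = w ++ [b]) ∨ (∃ b, w = q.1.1 ++ [b]) ∨ q.1.1 = w)) ∨
      (c.2 = true ∧ q.1.1 = w)) ?_
  rintro ⟨⟨u, hu⟩, i⟩ hp ⟨⟨v, hv⟩, j⟩ hq
  rw [Finset.mem_coe, mem_blowUpPart] at hp hq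
  obtain ⟨⟨l, rfl⟩, hp⟩ := hp
  simp only [blowUp_adj, decide_eq_true_eq, Subtype.mk.injEq] at *
  constructor
  · rintro ((⟨b, rfl⟩ | ⟨b, hb⟩) | ⟨rfl, hij⟩)
    · refine absurd ⟨⟨l ++ [b], by simp⟩, fun h => ?_⟩ hq
      simp at h
    · rcases List.eq_nil_or_concat l with rfl | ⟨l, c, rfl⟩
      · exact Or.inl ⟨by simp, Or.inr (Or.inl ⟨b, by simpa using hb⟩)⟩
      · rw [List.concat_eq_append, ← List.append_assoc] at hb
        obtain ⟨hv', -⟩ := List.append_inj' hb rfl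
        have hl : l = [] := by
          by_contra hl
          refine hq ⟨⟨l, hv'⟩, fun h => ?_⟩
          rw [← hv'] at h
          simp [hl] at h
        subst hl
        exact Or.inr ⟨⟨c, by simp⟩, by simpa using hv'.symm⟩
    · have hl : l = [] := by
        by_contra hl
        exact hq ⟨⟨l, rfl⟩, fun h => by simp [hl] at h⟩
      exact Or.inl ⟨by simp [hl], Or.inr (Or.inr (by simp [hl]))⟩
  · rintro (⟨hl, h1 | h1 | h1⟩ | ⟨⟨b, hl⟩, h1⟩)
    · exact Or.inl (Or.inl (by rwa [hl]))
    · exact Or.inl (Or.inr (by rwa [hl]))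
    · refine Or.inr ⟨hl.trans h1.symm, ?_⟩
      rintro rfl
      exact hq ⟨⟨[], by simp [h1]⟩, fun _ => hp hl⟩
    · exact Or.inl (Or.inr ⟨b, by rw [h1, hl]⟩)

theorem blowUpPart_eq_insert {h t : ℕ} {w : List Bool} (hw : w.length ≤ h) {k : ℕ} (hk : k < t) :
    open Classical in
    blowUpPart h t w k = {(⟨w, hw⟩, ⟨k, hk⟩)} ∪ blowUpPart h t w (k + 1) := by
  ext ⟨⟨u, hu⟩, ⟨i, hi⟩⟩
  simp only [mem_blowUpPart, Finset.mem_union, Finset.mem_singleton, Prod.mk.injEq,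
    Subtype.mk.injEq, Fin.mk.injEq]
  constructor
  · rintro ⟨h1, h2⟩
    by_cases hi' : u = w ∧ i = k
    · exact Or.inl hi'
    · refine Or.inr ⟨h1, fun h3 => ?_⟩
      have := h2 h3
      have : i ≠ k := fun h => hi' ⟨h3, h⟩
      omega
  · rintro (⟨rfl, rfl⟩ | ⟨h1, h2⟩)
    · exact ⟨List.prefix_rfl, fun _ => le_rfl⟩
    · exact ⟨h1, fun h3 => (Nat.le_succ k).trans (h2 h3)⟩

theorem blowUpPart_eq_union {h t : ℕ} (w : List Bool) {k : ℕ} (hk : t ≤ k) :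
    open Classical in
    blowUpPart h t w k = blowUpPart h t (w ++ [true]) 0 ∪ blowUpPart h t (w ++ [false]) 0 := by
  ext ⟨⟨u, hu⟩, ⟨i, hi⟩⟩
  simp only [mem_blowUpPart, Finset.mem_union, Nat.zero_le, implies_true, and_true]
  constructor
  · rintro ⟨⟨l, rfl⟩, h2⟩
    cases l with
    | nil => exact absurd (h2 (by simp)) (by omega)
    | cons b l =>
      cases b
      · exact Or.inr ⟨l, by simp⟩
      · exact Or.inl ⟨l, by simp⟩
  · rintro (⟨l, rfl⟩ | ⟨l, rfl⟩)
    · exact ⟨⟨true :: l, by simp⟩, fun h => by simp at h⟩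
    · exact ⟨⟨false :: l, by simp⟩, fun h => by simp at h⟩

theorem disjoint_blowUpPart_children (h t : ℕ) (w : List Bool) :
    Disjoint (blowUpPart h t (w ++ [true]) 0) (blowUpPart h t (w ++ [false]) 0) := by
  rw [Finset.disjoint_left]
  intro p h1 h2
  have h3 := List.prefix_of_prefix_length_le (mem_blowUpPart.mp h1).1 (mem_blowUpPart.mp h2).1
    (by simp)
  simpa using h3.eq_of_length (by simp)

theorem rankWidth_blowUp_le (h t : ℕ) (ht : 1 ≤ t) : rankWidth (blowUp h t) ≤ (4 : ℕ) := by
  classical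
  have hroot : Nonempty (BinaryTreeNode h × Fin t) := ⟨(⟨[], Nat.zero_le h⟩, ⟨0, ht⟩)⟩
  refine rankWidth_le_of_forall_exists_split (blowUp h t)
    (fun X => X.card = 1 ∨ ∃ w k, X = blowUpPart h t w k) (Or.inr ⟨[], 0, ?_⟩) ?_ ?_
  · ext p
    simp [mem_blowUpPart]
  · rintro X (hX | ⟨w, k, rfl⟩) h2
    · omega
    have hw : w.length ≤ h := by
      obtain ⟨p, hp⟩ := Finset.card_pos.mp (show 0 < (blowUpPart h t w k).card by omega)
      exact (mem_blowUpPart.mp hp).1.length_le.trans p.1.2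
    by_cases hk : k < t
    · have hX := blowUpPart_eq_insert hw hk
      refine ⟨{(⟨w, hw⟩, ⟨k, hk⟩)}, blowUpPart h t w (k + 1), Or.inl (Finset.card_singleton _),
        Or.inr ⟨w, k + 1, rfl⟩, Finset.singleton_nonempty _, ?_, ?_, hX⟩
      · by_contra hne
        rw [Finset.not_nonempty_iff_eq_empty] at hne
        rw [hX, hne, Finset.union_empty, Finset.card_singleton] at h2
        omega
      · rw [Finset.disjoint_singleton_left, mem_blowUpPart]
        exact fun hc => absurd (hc.2 rfl) (by simp)
    · have hX := blowUpPart_eq_union (h := h) w (not_lt.mp hk)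
      -- With the vertices over `w` used up, a nonempty part must have vertices strictly below `w`.
      have hw' : w.length < h := by
        obtain ⟨p, hp⟩ := Finset.card_pos.mp (show 0 < (blowUpPart h t w k).card by omega)
        rw [hX, Finset.mem_union, mem_blowUpPart, mem_blowUpPart] at hp
        rcases hp with hp | hp <;>
        · have := hp.1.length_le.trans p.1.2
          simp at this
          omega
      have hne : ∀ b, (blowUpPart h t (w ++ [b]) 0).Nonempty := fun b =>
        ⟨(⟨w ++ [b], by simpa using hw'⟩, ⟨0, ht⟩), by simp [mem_blowUpPart]⟩
      exact ⟨_, _, Or.inr ⟨_, _, rfl⟩, Or.inr ⟨_, _, rfl⟩, hne true, hne false,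
        disjoint_blowUpPart_children h t w, hX⟩
  · rintro X (hX | ⟨w, k, rfl⟩)
    · obtain ⟨p, rfl⟩ := Finset.card_eq_one.mp hX
      refine (cutRank_le_card (κ := Unit) (blowUp h t) _ (fun _ => ())
        (fun _ q => (blowUp h t).Adj p q) ?_).trans (by simp)
      intro u hu v _
      rw [Finset.mem_coe, Finset.mem_singleton] at hu
      rw [hu]
    · exact cutRank_blowUpPart_le h t w k

/-! ### Treewidth and cliques -/

namespace SimpleGraph

variable {N : Type*} {T : SimpleGraph N}

/-- In a connected induced subgraph, any two vertices are joined by a path inside it. -/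
theorem exists_isPath_support_subset_of_connected_induce {S : Set N} (hS : (T.induce S).Connected)
    {a b : N} (ha : a ∈ S) (hb : b ∈ S) :
    ∃ p : T.Walk a b, p.IsPath ∧ ∀ x ∈ p.support, x ∈ S := by
  classical
  obtain ⟨p⟩ := hS.preconnected ⟨a, ha⟩ ⟨b, hb⟩
  let f : T.induce S →g T := (Embedding.induce S).toHom
  let q : T.Walk (f ⟨a, ha⟩) (f ⟨b, hb⟩) := p.bypass.map f
  refine ⟨q, p.bypass_isPath.map Subtype.val_injective, fun x hx => ?_⟩
  have hx' : x ∈ q.support := hx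
  rw [Walk.support_map, List.mem_map] at hx'
  obtain ⟨y, -, rfl⟩ := hx'
  exact y.2

/-- A connected set `S` of nodes of a connected graph contains, for each node `i`, a node `y` such
that every node of `S` can be reached from `i` by a path through `y`. -/
theorem exists_gate (hT : T.Connected) {S : Set N} (hS : (T.induce S).Connected) (i : N) :
    ∃ y ∈ S, ∀ z ∈ S, ∃ p : T.Walk i z, p.IsPath ∧ y ∈ p.support := by
  classical
  have hne : S.Nonempty := Set.nonempty_coe_sort.mp hS.nonempty
  -- The gate is a node of `S` nearest to `i`. A shortest path from `i` to `y` meets `S` only in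
  -- `y`, so appending a path inside `S` yields a path.
  obtain ⟨y, hy, hmin⟩ := exists_minimalFor_of_wellFoundedLT (· ∈ S) (T.dist i) hne
  refine ⟨y, hy, fun z hz => ?_⟩
  obtain ⟨p, hp⟩ := hT.exists_walk_length_eq_dist i y
  obtain ⟨q, hq, hqS⟩ := exists_isPath_support_subset_of_connected_induce hS hy hz
  refine ⟨p.append q, ?_, by simp⟩
  rw [Walk.isPath_def, Walk.support_append]
  refine List.Nodup.append (p.isPath_of_length_eq_dist hp).support_nodup
    hq.support_nodup.tail ?_
  intro x hxp hxq
  have hxS : x ∈ S := hqS x (List.mem_of_mem_tail hxq)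
  have hxy : x ≠ y := by
    rintro rfl
    have := hq.support_nodup
    rw [← Walk.cons_tail_support] at this
    exact (List.nodup_cons.mp this).1 hxq
  have h1 := p.length_takeUntil_lt_length hxp hxy
  have h2 := T.dist_le (p.takeUntil x hxp)
  have h3 : T.dist i y ≤ T.dist i x := hmin hxS (by omega)
  omega

/-- The Helly property of subtrees: pairwise intersecting connected sets of nodes of a tree have a
common node. -/
theorem IsTree.helly (hT : T.IsTree) {ι : Type*} (K : Finset ι) (S : ι → Set N)
    (hS : ∀ i ∈ K, (T.induce (S i)).Connected)
    (hK : ∀ i ∈ K, ∀ j ∈ K, (S i ∩ S j).Nonempty) : ∃ x, ∀ i ∈ K, x ∈ S i := by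
  classical
  induction K using Finset.induction_on with
  | empty => exact ⟨hT.connected.nonempty.some, by simp⟩
  | insert v K _ ih =>
    obtain ⟨i, hi⟩ := ih (fun u hu => hS u (Finset.mem_insert_of_mem hu))
      (fun u hu w hw => hK u (Finset.mem_insert_of_mem hu) w (Finset.mem_insert_of_mem hw))
    -- The path from `i` to a common node `z` of `S u` and `S v` is unique: it passes through the
    -- gate `y` of `S v` and stays inside `S u`. So `y` lies in every `S u`.
    obtain ⟨y, hy, hgate⟩ := exists_gate hT.connected (hS v (Finset.mem_insert_self v K)) i
    refine ⟨y, fun u hu => ?_⟩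
    rcases Finset.mem_insert.mp hu with rfl | hu'
    · exact hy
    obtain ⟨z, hzu, hzv⟩ := hK u hu v (Finset.mem_insert_self v K)
    obtain ⟨p, hp, hyp⟩ := hgate z hzv
    obtain ⟨q, hq, hqS⟩ := exists_isPath_support_subset_of_connected_induce (hS u hu)
      (hi u hu') hzu
    have hpq : p = q := congrArg Subtype.val
      ((hT.isAcyclic.subsingleton_path i z).elim (⟨p, hp⟩ : T.Path i z) ⟨q, hq⟩)
    exact hqS y (hpq ▸ hyp)

end SimpleGraph

/-- A clique is contained in a bag of every tree decomposition. -/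
theorem TreeDecomposition.exists_isClique_subset_bag {V : Type} {G : SimpleGraph V}
    (D : TreeDecomposition G) (K : Finset V) (hK : G.IsClique (K : Set V)) :
    ∃ x : D.Node, K ⊆ D.bag x := by
  refine D.isTree.helly K (fun v => {x | v ∈ D.bag x}) (fun v _ => D.connected v)
    fun u hu v hv => ?_
  by_cases h : u = v
  · obtain ⟨x, hx⟩ := D.vertex_mem u
    exact ⟨x, hx, h ▸ hx⟩
  · exact D.edge_mem u v (hK hu hv h)

theorem card_le_treewidth_add_one {V : Type} [Fintype V] {G : SimpleGraph V} (K : Finset V)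
    (hK : G.IsClique (K : Set V)) : K.card ≤ treewidth G + 1 := by
  suffices K.card - 1 ≤ treewidth G by omega
  refine le_ciInf fun D => ?_
  obtain ⟨x, hx⟩ := D.exists_isClique_subset_bag K hK
  exact Nat.sub_le_sub_right ((Finset.card_le_card hx).trans
    (Finset.le_sup (f := fun x : D.Node => (D.bag x).card) (Finset.mem_univ x))) 1

theorem le_treewidth_blowUp_add_one (h t : ℕ) : t ≤ treewidth (blowUp h t) + 1 := by
  classical
  let K : Finset (BinaryTreeNode h × Fin t) := Finset.univ.image fun j => (⟨[], Nat.zero_le h⟩, j)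
  have hcard : K.card = t := by
    rw [Finset.card_image_of_injective _ (Prod.mk_right_injective _), Finset.card_univ,
      Fintype.card_fin]
  have hK : (blowUp h t).IsClique (K : Set (BinaryTreeNode h × Fin t)) := by
    intro p hp q hq hpq
    simp only [K, Finset.coe_image, Finset.coe_univ, Set.image_univ, Set.mem_range] at hp hq
    obtain ⟨i, rfl⟩ := hp
    obtain ⟨j, rfl⟩ := hq
    exact Or.inr ⟨rfl, fun hij => hpq (Prod.ext rfl hij)⟩
  simpa [hcard] using card_le_treewidth_add_one K hK

/-! ### Distances of dyadic multiples to the integers -/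

/-- The sum of the distances of `n`, `n / 2`, ..., `n / 2 ^ (K - 1)` to the nearest integers. -/
noncomputable def dyadicNorm (K : ℕ) (n : ℤ) : ℝ :=
  ∑ i ∈ Finset.range K, ‖((n / 2 ^ i : ℝ) : UnitAddCircle)‖

theorem dyadicNorm_zero (K : ℕ) : dyadicNorm K 0 = 0 := by simp [dyadicNorm]

theorem dyadicNorm_neg (K : ℕ) (n : ℤ) : dyadicNorm K (-n) = dyadicNorm K n := by
  unfold dyadicNorm
  refine Finset.sum_congr rfl fun i _ => ?_
  rw [Int.cast_neg, neg_div, AddCircle.coe_neg, norm_neg]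

theorem dyadicNorm_add_le (K : ℕ) (m n : ℤ) :
    dyadicNorm K (m + n) ≤ dyadicNorm K m + dyadicNorm K n := by
  unfold dyadicNorm
  rw [← Finset.sum_add_distrib]
  refine Finset.sum_le_sum fun i _ => ?_
  rw [Int.cast_add, add_div, AddCircle.coe_add]
  exact norm_add_le _ _

/-- The terms with `i ≤ j` vanish, and the others are at most `1/2, 1/4, ...`, a geometric series
with sum 1. -/
theorem dyadicNorm_two_pow_le (K j : ℕ) : dyadicNorm K (2 ^ j) ≤ 1 := by
  have key : ∀ m : ℕ, dyadicNorm (j + 1 + m) (2 ^ j) ≤ 1 - 1 / 2 ^ m := by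
    intro m
    induction m with
    | zero =>
      refine (Finset.sum_eq_zero fun i hi => ?_).trans_le (by norm_num)
      have hij : i ≤ j := by simpa [Nat.lt_succ_iff] using hi
      have : (((2 ^ j : ℤ) : ℝ) / 2 ^ i : ℝ) = ((2 ^ (j - i) : ℤ) : ℝ) := by
        push_cast
        rw [div_eq_iff (by positivity), ← pow_add, Nat.sub_add_cancel hij]
      rw [this, UnitAddCircle.norm_eq, round_intCast, sub_self, abs_zero]
    | succ m ih =>
      have hstep : ‖((((2 ^ j : ℤ) : ℝ) / 2 ^ (j + 1 + m) : ℝ) : UnitAddCircle)‖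
          ≤ 1 / 2 ^ (m + 1) := by
        have : (((2 ^ j : ℤ) : ℝ) / 2 ^ (j + 1 + m) : ℝ) = 1 / 2 ^ (m + 1) := by
          push_cast
          field_simp
          ring
        rw [this, UnitAddCircle.norm_eq]
        refine (round_le _ 0).trans (le_of_eq ?_)
        rw [Int.cast_zero, sub_zero, abs_of_pos (by positivity)]
      rw [← add_assoc, dyadicNorm, Finset.sum_range_succ]
      refine (add_le_add ih hstep).trans (le_of_eq ?_)
      rw [pow_succ]
      field_simp
      ring
  have hmono : dyadicNorm K (2 ^ j) ≤ dyadicNorm (j + 1 + K) (2 ^ j) :=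
    Finset.sum_le_sum_of_subset_of_nonneg (Finset.range_subset_range.mpr (by omega))
      fun _ _ _ => norm_nonneg _
  have : (0 : ℝ) < 1 / 2 ^ K := by positivity
  linarith [key K]

theorem dyadicNorm_two_pow_sub_one_le (K j : ℕ) : dyadicNorm K (2 ^ j - 1) ≤ 2 := by
  have h1 := dyadicNorm_add_le K (2 ^ j) (-1)
  have h2 := dyadicNorm_two_pow_le K j
  have h3 := dyadicNorm_two_pow_le K 0
  rw [pow_zero, ← dyadicNorm_neg] at h3
  rw [← sub_eq_add_neg] at h1
  linarith

/-- For `n = (4 ^ k - 1) / 3` and `1 ≤ i ≤ 2 * k`, the number `n / 2 ^ i` is far from the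
integers. -/
theorem one_sixth_le_norm {n : ℤ} {k i : ℕ} (hn : 3 * n + 1 = 4 ^ k) (hi : 1 ≤ i)
    (hik : i ≤ 2 * k) : 1 / 6 ≤ ‖((n / 2 ^ i : ℝ) : UnitAddCircle)‖ := by
  rw [UnitAddCircle.norm_eq]
  generalize round ((n : ℝ) / 2 ^ i) = z
  -- Since 3 does not divide a power of 2, `q` is nonzero: `2 ^ (2 * k - i) / 3` is at least `1/3`
  -- away from `z`. It differs from `n / 2 ^ i` by `1 / (3 * 2 ^ i)`, at most `1/6`.
  obtain ⟨q, hq⟩ : ∃ q : ℤ, q = 2 ^ (2 * k - i) - 3 * z := ⟨_, rfl⟩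
  have h4 : (4 : ℤ) ^ k = 2 ^ i * 2 ^ (2 * k - i) := by
    rw [← pow_add, Nat.add_sub_cancel' hik, pow_mul]
    norm_num
  have hq0 : q ≠ 0 := by
    rintro rfl
    have h3 : (3 : ℤ) ∣ 2 ^ (2 * k - i) := ⟨z, by linarith⟩
    have := Int.prime_three.dvd_of_dvd_pow h3
    norm_num at this
  have hmain : 3 * (n - z * 2 ^ i) = 2 ^ i * q - 1 := by
    rw [hq]
    linear_combination hn + h4
  have h2 : (2 : ℤ) ≤ 2 ^ i := by
    calc (2 : ℤ) = 2 ^ 1 := by norm_num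
      _ ≤ 2 ^ i := pow_le_pow_right₀ (by norm_num) hi
  have habs : (2 : ℤ) ^ i ≤ 6 * |n - z * 2 ^ i| := by
    rcases lt_or_gt_of_ne hq0 with h | h
    · have : 2 ^ i * q ≤ 2 ^ i * (-1) := mul_le_mul_of_nonneg_left (by omega) (by positivity)
      have := neg_abs_le (n - z * 2 ^ i)
      linarith
    · have : 2 ^ i * 1 ≤ 2 ^ i * q := mul_le_mul_of_nonneg_left (by omega) (by positivity)
      have := le_abs_self (n - z * 2 ^ i)
      linarith
  have hpos : (0 : ℝ) < 2 ^ i := by positivity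
  have heq : (n : ℝ) / 2 ^ i - z = (n - z * 2 ^ i) / 2 ^ i := by field_simp
  rw [heq, abs_div, abs_of_pos hpos, le_div_iff₀ hpos]
  have : (2 : ℝ) ^ i ≤ 6 * |(n : ℝ) - z * 2 ^ i| := by exact_mod_cast habs
  linarith

/-- The term `i = 0` is discarded; each of the other `2 * k` terms is at least `1/6`. -/
theorem le_dyadicNorm {n : ℤ} {k : ℕ} (hn : 3 * n + 1 = 4 ^ k) :
    (k : ℝ) / 3 ≤ dyadicNorm (2 * k + 1) n := by
  rw [dyadicNorm, Finset.sum_range_succ']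
  have : ∑ i ∈ Finset.range (2 * k), (1 / 6 : ℝ) ≤
      ∑ i ∈ Finset.range (2 * k), ‖((n / 2 ^ (i + 1) : ℝ) : UnitAddCircle)‖ :=
    Finset.sum_le_sum fun i hi => one_sixth_le_norm hn (by omega)
      (by have := Finset.mem_range.mp hi; omega)
  rw [Finset.sum_const, Finset.card_range, nsmul_eq_mul] at this
  push_cast at this
  have h0 := norm_nonneg ((n / 2 ^ 0 : ℝ) : UnitAddCircle)
  linarith

/-! ### Edge boundaries in complete binary trees -/

/-- The binary words of length less than `d`. -/
def shortWords : ℕ → Finset (List Bool)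
  | 0 => ∅
  | d + 1 => insert [] ((shortWords d).image (List.cons true) ∪
      (shortWords d).image (List.cons false))

theorem mem_shortWords {d : ℕ} {w : List Bool} : w ∈ shortWords d ↔ w.length < d := by
  induction d generalizing w with
  | zero => simp [shortWords]
  | succ d ih =>
    cases w with
    | nil => simp [shortWords]
    | cons b w => cases b <;> simp [shortWords, ih]

/-- Here the first letter of a word is the step taken at the root, so the inductions on height pass
to the two subtrees by prepending a letter. -/
theorem sum_shortWords_succ {M : Type*} [AddCommMonoid M] (d : ℕ) (f : List Bool → M) :
    ∑ w ∈ shortWords (d + 1), f w =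
      f [] + (∑ w ∈ shortWords d, f (true :: w) + ∑ w ∈ shortWords d, f (false :: w)) := by
  rw [shortWords, Finset.sum_insert (by simp), Finset.sum_union, Finset.sum_image, Finset.sum_image]
  · exact fun _ _ _ _ h => (List.cons.inj h).2
  · exact fun _ _ _ _ h => (List.cons.inj h).2
  · rw [Finset.disjoint_left]
    simp

section Boundary

open Classical in
/-- The number of words of length at most `d` in `S`. -/
noncomputable def wordCount (d : ℕ) (S : Set (List Bool)) : ℤ :=
  ∑ w ∈ shortWords (d + 1), if w ∈ S then 1 else 0

open Classical in
/-- The number of edges of the complete binary tree of height `d` between `S` and its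
complement. -/
noncomputable def edgeBoundary (d : ℕ) (S : Set (List Bool)) : ℕ :=
  ∑ w ∈ shortWords d, ∑ b : Bool, if (w ∈ S ↔ w ++ [b] ∈ S) then 0 else 1

open Classical in
theorem wordCount_succ (d : ℕ) (S : Set (List Bool)) :
    wordCount (d + 1) S = (if [] ∈ S then 1 else 0) +
      (wordCount d (List.cons true ⁻¹' S) + wordCount d (List.cons false ⁻¹' S)) :=
  sum_shortWords_succ (d + 1) _

open Classical in
theorem edgeBoundary_succ (d : ℕ) (S : Set (List Bool)) :
    edgeBoundary (d + 1) S = (∑ b : Bool, if ([] ∈ S ↔ [b] ∈ S) then 0 else 1) +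
      (edgeBoundary d (List.cons true ⁻¹' S) + edgeBoundary d (List.cons false ⁻¹' S)) :=
  sum_shortWords_succ d _

open Classical in
/-- Up to the contribution of the root, the size of `S` is a sum of numbers `± (2 ^ j - 1)`, one
for each boundary edge. -/
theorem le_mul_edgeBoundary (W : ℤ → ℝ) (h0 : W 0 = 0) (hneg : ∀ n, W (-n) = W n)
    (hadd : ∀ m n, W (m + n) ≤ W m + W n) {c : ℝ} (hc : ∀ j : ℕ, W (2 ^ j - 1) ≤ c)
    (d : ℕ) (S : Set (List Bool)) :
    W (wordCount d S - (if [] ∈ S then 2 ^ (d + 1) - 1 else 0)) ≤ c * edgeBoundary d S := by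
  induction d generalizing S with
  | zero =>
    by_cases h : [] ∈ S <;> simp [wordCount, edgeBoundary, shortWords, Finset.filter_singleton, h, h0]
  | succ d ih =>
    -- An edge from the root contributes the full size of the child's subtree, with a sign, if it is
    -- a boundary edge, and nothing otherwise.
    have hedge : ∀ b : Bool, W ((if [b] ∈ S then 2 ^ (d + 1) - 1 else 0) -
        (if [] ∈ S then 2 ^ (d + 1) - 1 else 0)) ≤
          c * ((if ([] ∈ S ↔ [b] ∈ S) then 0 else 1 : ℕ) : ℝ) := by
      intro b
      have h1 := hc (d + 1)
      by_cases hr : [] ∈ S <;> by_cases hb : [b] ∈ S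
      · simp [hr, hb, h0]
      · simpa only [hr, hb, if_true, if_false, zero_sub, hneg, true_iff, not_false_eq_true,
          Nat.cast_one, mul_one] using h1
      · simpa only [hr, hb, if_true, if_false, sub_zero, false_iff, not_true_eq_false,
          Nat.cast_one, mul_one] using h1
      · simp [hr, hb, h0]
    have hT := ih (List.cons true ⁻¹' S)
    have hF := ih (List.cons false ⁻¹' S)
    have hT' := hedge true
    have hF' := hedge false
    simp only [Set.mem_preimage] at hT hF
    rw [wordCount_succ, edgeBoundary_succ, Fintype.sum_bool]
    -- If the root lies in `S`, its own 1 and the full sizes of the two subtrees add up to `2 ^ (d +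
    -- 2) - 1`.
    have heq : (if [] ∈ S then 1 else 0) +
        (wordCount d (List.cons true ⁻¹' S) + wordCount d (List.cons false ⁻¹' S)) -
          (if [] ∈ S then 2 ^ (d + 1 + 1) - 1 else 0) =
        ((wordCount d (List.cons true ⁻¹' S) - if [true] ∈ S then 2 ^ (d + 1) - 1 else 0) +
          (wordCount d (List.cons false ⁻¹' S) - if [false] ∈ S then 2 ^ (d + 1) - 1 else 0)) +
        (((if [true] ∈ S then 2 ^ (d + 1) - 1 else 0) -
          (if [] ∈ S then 2 ^ (d + 1) - 1 else 0)) +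
        ((if [false] ∈ S then 2 ^ (d + 1) - 1 else 0) -
          (if [] ∈ S then 2 ^ (d + 1) - 1 else 0))) := by
      by_cases hr : [] ∈ S <;> simp only [hr, if_true, if_false] <;> ring
    rw [heq]
    push_cast at hT' hF' ⊢
    have h1 := hadd _ _ |>.trans (add_le_add hT hF)
    have h2 := hadd _ _ |>.trans (add_le_add hT' hF')
    refine (hadd _ _).trans ((add_le_add h1 h2).trans (le_of_eq ?_))
    ring

/-- A set that has `(4 ^ k - 1) / 3` elements has many boundary edges. -/
theorem le_edgeBoundary {d k : ℕ} (hk : 1 ≤ k) (hkd : 2 * k ≤ d + 1) (S : Set (List Bool))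
    (hS : 3 * wordCount d S + 1 = 4 ^ k) : (k : ℝ) / 3 ≤ 4 * edgeBoundary d S := by
  classical
  have h4 : (4 : ℤ) ≤ 4 ^ k := by
    calc (4 : ℤ) = 4 ^ 1 := by norm_num
      _ ≤ 4 ^ k := pow_le_pow_right₀ (by norm_num) hk
  have hsize : (4 : ℤ) ^ k ≤ 2 ^ (d + 1) := by
    calc (4 : ℤ) ^ k = 2 ^ (2 * k) := by rw [pow_mul]; norm_num
      _ ≤ 2 ^ (d + 1) := pow_le_pow_right₀ (by norm_num) hkd
  -- The indicator of nonzero integers as `W` shows that a set without boundary is empty or the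
  -- whole tree, which its size excludes.
  have hb : 1 ≤ edgeBoundary d S := by
    have h := le_mul_edgeBoundary (fun n => if n = 0 then 0 else 1) (by simp) (by simp)
      (fun m n => by
        by_cases hm : m = 0 <;> by_cases hn : n = 0
        · simp [hm, hn]
        · simp [hm, hn]
        · simp [hm, hn]
        · simp only [hm, hn, if_false]
          split_ifs <;> norm_num) (c := 1) (fun j => by split_ifs <;> norm_num) d S
    by_contra hlt
    have h0 : edgeBoundary d S = 0 := by omega
    rw [h0] at h
    have hne : wordCount d S - (if [] ∈ S then 2 ^ (d + 1) - 1 else 0) ≠ 0 := by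
      split_ifs <;> omega
    simp only [hne, if_false] at h
    norm_num at h
  have h1 := le_mul_edgeBoundary (dyadicNorm (2 * k + 1)) (dyadicNorm_zero _) (dyadicNorm_neg _)
    (dyadicNorm_add_le _) (dyadicNorm_two_pow_sub_one_le _) d S
  -- The root's contribution costs at most 2 more, so `k / 3` is at most twice the boundary plus 2;
  -- as the boundary is nonempty, this is at most four times the boundary.
  have h2 := dyadicNorm_add_le (2 * k + 1)
    (wordCount d S - (if [] ∈ S then 2 ^ (d + 1) - 1 else 0))
    (if [] ∈ S then 2 ^ (d + 1) - 1 else 0)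
  have h3 : dyadicNorm (2 * k + 1) (if [] ∈ S then 2 ^ (d + 1) - 1 else 0) ≤ 2 := by
    split_ifs
    · exact dyadicNorm_two_pow_sub_one_le _ _
    · rw [dyadicNorm_zero]
      norm_num
  rw [sub_add_cancel] at h2
  have hb' : (1 : ℝ) ≤ edgeBoundary d S := by exact_mod_cast hb
  linarith [le_dyadicNorm hS]

end Boundary

/-! ### The linear rank-width of the blow-up -/

/-- The words whose vertex with second coordinate `z` lies in `X`. -/
def wordTrace {h t : ℕ} (z : Fin t) (X : Set (BinaryTreeNode h × Fin t)) : Set (List Bool) :=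
  {w | ∃ hw : w.length ≤ h, (⟨w, hw⟩, z) ∈ X}

theorem mem_wordTrace {h t : ℕ} {z : Fin t} {X : Set (BinaryTreeNode h × Fin t)}
    {w : List Bool} : w ∈ wordTrace z X ↔ ∃ hw : w.length ≤ h, (⟨w, hw⟩, z) ∈ X :=
  Iff.rfl

/-- Sort the boundary edges by the depth of the parent modulo 3, the letter of the child, and the
side of the parent: `3 * 2 * 2 = 12` classes. Each class is an induced matching across the cut. If
the parent end of `p` is adjacent to the child end of `q`, either the two edges share their parent,
hence coincide because their letters agree, or the parent depths differ by 2, which is impossible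
modulo 3. -/
theorem edgeBoundary_le_cutRank {h t : ℕ} (z : Fin t) (X : Set (BinaryTreeNode h × Fin t)) :
    edgeBoundary h (wordTrace z X) ≤ 12 * cutRank (blowUp h t) X := by
  classical
  let S := wordTrace z X
  let E : Finset (List Bool × Bool) :=
    (shortWords h ×ˢ Finset.univ).filter fun p => ¬ (p.1 ∈ S ↔ p.1 ++ [p.2] ∈ S)
  have hE : edgeBoundary h S = E.card := by
    rw [edgeBoundary, ← Finset.sum_product', Finset.card_filter]
    refine Finset.sum_congr rfl fun p _ => ?_
    by_cases hp : p.1 ∈ S ↔ p.1 ++ [p.2] ∈ S <;> simp [hp]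
  let cls : List Bool × Bool → ZMod 3 × Bool × Bool := fun p =>
    ((p.1.length : ZMod 3), p.2, decide (p.1 ∈ S))
  have hfib : ∀ c ∈ E.image cls, (E.filter fun p => cls p = c).card ≤ cutRank (blowUp h t) X := by
    rintro ⟨r, s, o⟩ -
    let I := {p // p ∈ E.filter fun p => cls p = (r, s, o)}
    have hI : ∀ p : I, p.1.1.length < h ∧ ¬ (p.1.1 ∈ S ↔ p.1.1 ++ [p.1.2] ∈ S) ∧
        (p.1.1.length : ZMod 3) = r ∧ p.1.2 = s ∧ decide (p.1.1 ∈ S) = o := by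
      intro p
      have := p.2
      simp only [E, cls, Finset.mem_filter, Finset.mem_product, mem_shortWords, Finset.mem_univ,
        and_true, Prod.mk.injEq] at this
      exact ⟨this.1.1, this.1.2, this.2⟩
    let x : I → BinaryTreeNode h × Fin t := fun p => (⟨p.1.1, (hI p).1.le⟩, z)
    let y : I → BinaryTreeNode h × Fin t := fun p =>
      (⟨p.1.1 ++ [p.1.2], by simpa using (hI p).1⟩, z)
    have hx : ∀ p, x p ∈ X ↔ p.1.1 ∈ S := fun p => ⟨fun hp => ⟨_, hp⟩, fun ⟨_, hp⟩ => hp⟩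
    have hy : ∀ p, y p ∈ X ↔ p.1.1 ++ [p.1.2] ∈ S := fun p => ⟨fun hp => ⟨_, hp⟩, fun ⟨_, hp⟩ => hp⟩
    have hxy : ∀ p q, (blowUp h t).Adj (x p) (y q) ↔ p = q := by
      intro p q
      obtain ⟨-, -, hpr, hps, -⟩ := hI p
      obtain ⟨-, -, hqr, hqs, -⟩ := hI q
      rw [blowUp_adj]
      simp only [x, y]
      constructor
      · rintro ((⟨b, hb⟩ | ⟨b, hb⟩) | ⟨-, hne⟩)
        · refine Subtype.ext (Prod.ext (List.append_inj' hb rfl).1.symm (hps.trans hqs.symm))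
        · exfalso
          rw [hb, List.length_append, List.length_append, List.length_singleton,
            List.length_singleton, Nat.cast_add, Nat.cast_add, Nat.cast_one, hqr, add_assoc] at hpr
          have := add_eq_left.mp hpr
          revert this
          decide
        · exact absurd rfl hne
      · rintro rfl
        exact Or.inl (Or.inl ⟨_, rfl⟩)
    have hcard : (E.filter fun p => cls p = (r, s, o)).card = Fintype.card I := by
      rw [Fintype.card_coe]
    rw [hcard]
    cases o with
    | true =>
      have hS : ∀ p : I, p.1.1 ∈ S := fun p => of_decide_eq_true (hI p).2.2.2.2
      exact card_le_cutRank _ X x y (fun p => (hx p).mpr (hS p))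
        (fun p hp => (hI p).2.1 (iff_of_true (hS p) ((hy p).mp hp))) hxy
    | false =>
      have hS : ∀ p : I, p.1.1 ∉ S := fun p => of_decide_eq_false (hI p).2.2.2.2
      exact card_le_cutRank _ X y x
        (fun p => by_contra fun hp =>
          (hI p).2.1 (iff_of_false (hS p) fun hp' => hp ((hy p).mpr hp')))
        (fun p hp => hS p ((hx p).mp hp))
        fun p q => (SimpleGraph.adj_comm _ _ _).trans ((hxy q p).trans eq_comm)
  rw [hE]
  refine (Finset.card_le_mul_card_image E _ hfib).trans ?_
  rw [mul_comm]
  refine Nat.mul_le_mul_right _ ((Finset.card_le_univ _).trans (le_of_eq ?_))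
  simp [Fintype.card_prod, ZMod.card]

theorem card_shortWords (d : ℕ) : (shortWords d).card + 1 = 2 ^ d := by
  induction d with
  | zero => rfl
  | succ d ih =>
    rw [Finset.card_eq_sum_ones] at ih ⊢
    rw [sum_shortWords_succ, pow_succ]
    omega

theorem card_binaryTreeNode (h : ℕ) : Fintype.card (BinaryTreeNode h) + 1 = 2 ^ (h + 1) := by
  rw [← card_shortWords, Fintype.card_of_subtype (shortWords (h + 1))]
  exact fun w => mem_shortWords.trans Nat.lt_succ_iff

open Classical in
theorem wordCount_wordTrace {h t : ℕ} (z : Fin t) (X : Set (BinaryTreeNode h × Fin t)) :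
    wordCount h (wordTrace z X) =
      (Finset.univ.filter fun u : BinaryTreeNode h => (u, z) ∈ X).card := by
  rw [wordCount, Finset.sum_boole, ← Finset.card_map (Function.Embedding.subtype _)]
  congr 2
  ext w
  rw [Finset.mem_filter, mem_shortWords, mem_wordTrace]
  simp only [Finset.mem_filter, Finset.mem_map, Finset.mem_univ, true_and,
    Function.Embedding.subtype_apply, Subtype.exists, exists_and_right, exists_eq_right]
  exact ⟨fun hw => hw.2, fun hw => ⟨Nat.lt_succ_of_le hw.1, hw⟩⟩

/-- Every number of elements of a set of vertices is attained by a prefix of a layout. -/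
theorem exists_prefix_card {U : Type} [Fintype U] {N : ℕ} (f : U → Fin N)
    (hf : Function.Injective f) {n : ℕ} (hn : n ≤ Fintype.card U) :
    ∃ i, (Finset.univ.filter fun u => (f u : ℕ) < i).card = n := by
  classical
  -- As `i` grows by one the count grows by at most one, so the first `i` whose count reaches `n`
  -- attains it exactly.
  have hex : ∃ i, n ≤ (Finset.univ.filter fun u => (f u : ℕ) < i).card :=
    ⟨N, by simpa using hn⟩
  refine ⟨Nat.find hex, le_antisymm ?_ (Nat.find_spec hex)⟩
  rcases hi : Nat.find hex with _ | i
  · simp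
  have hlt : (Finset.univ.filter fun u => (f u : ℕ) < i).card < n :=
    not_le.mp (Nat.find_min hex (by omega))
  have hone : (Finset.univ.filter fun u => (f u : ℕ) = i).card ≤ 1 := by
    rw [Finset.card_le_one_iff]
    intro u v hu hv
    rw [Finset.mem_filter] at hu hv
    exact hf (Fin.ext (hu.2.trans hv.2.symm))
  have hsub : (Finset.univ.filter fun u => (f u : ℕ) < i + 1) ⊆
      (Finset.univ.filter fun u => (f u : ℕ) < i) ∪
        Finset.univ.filter fun u => (f u : ℕ) = i := by
    intro u
    simp only [Finset.mem_filter, Finset.mem_union, Finset.mem_univ, true_and]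
    omega
  have := (Finset.card_le_card hsub).trans (Finset.card_union_le _ _)
  omega

/-- The constant is `2 * 12 * 12`: `h ≤ 2 * k`, `k` is at most 12 times the boundary, and the
boundary at most 12 times the cut-rank. -/
theorem le_layoutWidth_blowUp {h t : ℕ} (ht : 1 ≤ t)
    (π : BinaryTreeNode h × Fin t ≃ Fin (Fintype.card (BinaryTreeNode h × Fin t))) :
    h ≤ 288 * layoutWidth (blowUp h t) π := by
  classical
  rcases Nat.eq_zero_or_pos h with rfl | hh
  · exact Nat.zero_le _
  -- This is the largest `k` with `2 * k ≤ h + 1`, the range allowed by `le_edgeBoundary`; it is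
  -- positive because `h` is.
  obtain ⟨k, hk⟩ : ∃ k, k = (h + 1) / 2 := ⟨_, rfl⟩
  obtain ⟨n, hn⟩ : ∃ n : ℕ, 3 * n + 1 = 4 ^ k := by
    clear hk
    induction k with
    | zero => exact ⟨0, rfl⟩
    | succ k ih =>
      obtain ⟨n, hn⟩ := ih
      exact ⟨4 * n + 1, by rw [pow_succ]; omega⟩
  have h4 : 4 ≤ 4 ^ k := by
    calc 4 = 4 ^ 1 := by norm_num
      _ ≤ 4 ^ k := Nat.pow_le_pow_right (by norm_num) (by omega)
  have hsize : 4 ^ k ≤ 2 ^ (h + 1) := by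
    calc 4 ^ k = 2 ^ (2 * k) := by rw [pow_mul]; norm_num
      _ ≤ 2 ^ (h + 1) := Nat.pow_le_pow_right (by norm_num) (by omega)
  have hU := card_binaryTreeNode h
  let z : Fin t := ⟨0, ht⟩
  obtain ⟨i, hi⟩ := exists_prefix_card (fun u : BinaryTreeNode h => π (u, z))
    (π.injective.comp (Prod.mk_left_injective z)) (n := n) (by omega)
  let X : Set (BinaryTreeNode h × Fin t) := {v | (π v : ℕ) < i}
  have hX : wordCount h (wordTrace z X) = n := by
    rw [wordCount_wordTrace, ← hi]
    simp only [X, Set.mem_ofPred_eq]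
  have hbound := le_edgeBoundary (d := h) (k := k) (by omega) (by omega) (wordTrace z X)
    (by rw [hX]; exact_mod_cast hn)
  have hrank := edgeBoundary_le_cutRank z X
  -- The prefix is proper and nonempty, as the width requires, because `n` lies strictly between 0
  -- and the number of tree nodes.
  have hle : cutRank (blowUp h t) X ≤ layoutWidth (blowUp h t) π := by
    refine Finset.le_sup (f := fun i => cutRank (blowUp h t) {v | (π v : ℕ) < i})
      (Finset.mem_Ico.mpr ⟨?_, ?_⟩)
    · by_contra hlt
      obtain rfl : i = 0 := by omega
      simp at hi
      omega
    · by_contra hge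
      rw [Finset.filter_true_of_mem fun u _ => (π (u, z)).2.trans_le (not_lt.mp hge),
        Finset.card_univ] at hi
      omega
  have hb : k ≤ 12 * edgeBoundary h (wordTrace z X) := by
    have : (k : ℝ) ≤ 12 * edgeBoundary h (wordTrace z X) := by linarith
    exact_mod_cast this
  omega

theorem le_linearRankWidth_blowUp {h t : ℕ} (ht : 1 ≤ t) :
    h ≤ 288 * linearRankWidth (blowUp h t) := by
  have : Nonempty (BinaryTreeNode h × Fin t ≃ Fin (Fintype.card (BinaryTreeNode h × Fin t))) :=
    ⟨Fintype.equivFin _⟩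
  obtain ⟨π, hπ⟩ := ciInf_mem (layoutWidth (blowUp h t))
  rw [linearRankWidth, ← hπ]
  exact le_layoutWidth_blowUp ht π

theorem mainTheorem6 :
    (∃ C : ℕ, ∀ h t : ℕ, 1 ≤ t → rankWidth (blowUp h t) ≤ (C : ℕ∞)) ∧
    (∃ c : ℝ, 0 < c ∧ ∀ h t : ℕ, 1 ≤ t → c * (h : ℝ) ≤ (linearRankWidth (blowUp h t) : ℝ)) ∧
    (∀ h t : ℕ, 1 ≤ t → (t : ℤ) - 1 ≤ (treewidth (blowUp h t) : ℤ)) := by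
  refine ⟨⟨4, rankWidth_blowUp_le⟩, ⟨1 / 288, by norm_num, fun h t ht => ?_⟩, fun h t _ => ?_⟩
  · have : (h : ℝ) ≤ 288 * linearRankWidth (blowUp h t) := by
      exact_mod_cast le_linearRankWidth_blowUp ht
    linarith
  · have := le_treewidth_blowUp_add_one h t
    omega
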